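/- Let $m>0$ and let $M=\{r>2m\}\subset\mathbb{R}^2$ carry the equatorial Schwarzschild optical metric $$\bar g=\frac{dr\otimes dr}{(1-\frac{2m}{r})^2}+\frac{r^2\,d\varphi\otimes d\varphi}{1-\frac{2m}{r}},$$ where $(r,\varphi)$ are polar coordinates; let $|\cdot|$ denote length and area with respect to $\bar g$, and orient all circles $\{r=\rho\}$ counterclockwise. Let $c\ge 3m$. Consider all cycles $C$ in $M$ consisting of finitely many closed piecewise smooth curves (for example a single closed curve) such that $C$ is homologous in $M$ to $\{r=c\}$ and such that $C$ and the photon sphere $\{r=3m\}$ together bound the same area as $\{3m\le r\le c\}$. The latter means: there are measurable sets $S_+\subset\{r\ge 3m\}$ and $S_-\subset\{r\le 3m\}$, contained in a compact subset of $M$, with $\partial(S_+-S_-)=C-\{r=3m\}$ in the sense of Stokes' theorem, i.e. $$\int_C\eta-\int_{\{r=3m\}}\eta=\int_{S_+}d\eta-\int_{S_-}d\eta$$ for all one-forms $\eta$ of class $C^1$ on $M$, and $$|S_+|-|S_-|=|\{3m\le r\le c\}|.$$ (If $C$ stays in $\{r\ge 3m\}$, then $S_-$ is a null set and $S_+$ is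 the region between $\{r=3m\}$ and $C$.) Then the circle $\{r=c\}$ is itself such a cycle, and it has the least length among them: $|\{r=c\}|\le |C|$ for every such $C$. -/

import Mathlib

open scoped ContDiff

namespace SchwarzschildOptical

/-- The radial coordinate on the plane. -/
noncomputable def radius (p : ℝ × ℝ) : ℝ := Real.sqrt (p.1 ^ 2 + p.2 ^ 2)

/-- The equatorial plane outside the horizon, the region `r > 2m` of the plane. -/
def exterior (m : ℝ) : Set (ℝ × ℝ) := {p | 2 * m < radius p}

/-- The coordinate one-form `dr` at `p`, evaluated on `v`. -/
noncomputable def dRadius (p v : ℝ × ℝ) : ℝ := (p.1 * v.1 + p.2 * v.2) / radius p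

/-- The coordinate one-form `dφ` at `p`, evaluated on `v`. -/
noncomputable def dAngle (p v : ℝ × ℝ) : ℝ := (p.1 * v.2 - p.2 * v.1) / radius p ^ 2

/-- The equatorial Schwarzschild optical metric
`(1 - 2m/r)⁻² dr ⊗ dr + r² (1 - 2m/r)⁻¹ dφ ⊗ dφ` at `p`. -/
noncomputable def optMetric (m : ℝ) (p v w : ℝ × ℝ) : ℝ :=
  1 / (1 - 2 * m / radius p) ^ 2 * (dRadius p v * dRadius p w)
    + radius p ^ 2 / (1 - 2 * m / radius p) * (dAngle p v * dAngle p w)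

/-- The Riemannian area density `√(det g)` in Cartesian coordinates. -/
noncomputable def areaDensity (m : ℝ) (p : ℝ × ℝ) : ℝ :=
  Real.sqrt
    (optMetric m p (1, 0) (1, 0) * optMetric m p (0, 1) (0, 1)
      - optMetric m p (1, 0) (0, 1) * optMetric m p (0, 1) (1, 0))

/-- The optical area of a set. -/
noncomputable def area (m : ℝ) (S : Set (ℝ × ℝ)) : ℝ := ∫ p in S, areaDensity m p

/-- `γ`, restricted to `[0,1]`, is a closed piecewise smooth curve in the region `r > 2m`. -/
structure IsLoop (m : ℝ) (γ : ℝ → ℝ × ℝ) : Prop where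
  mem : ∀ t ∈ Set.Icc (0 : ℝ) 1, γ t ∈ exterior m
  continuousOn : ContinuousOn γ (Set.Icc 0 1)
  closed : γ 0 = γ 1
  piecewise_smooth : ∃ (n : ℕ) (t : Fin (n + 1) → ℝ), Monotone t ∧ t 0 = 0 ∧ t (Fin.last n) = 1 ∧
    ∀ i : Fin n, ContDiffOn ℝ ∞ γ (Set.Icc (t i.castSucc) (t i.succ))

/-- The length of a curve in the optical metric. -/
noncomputable def loopLength (m : ℝ) (γ : ℝ → ℝ × ℝ) : ℝ :=
  ∫ t in (0 : ℝ)..1, Real.sqrt (optMetric m (γ t) (deriv γ t) (deriv γ t))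

/-- The total length of a finite family of closed curves. -/
noncomputable def cycleLength (m : ℝ) {k : ℕ} (C : Fin k → ℝ → ℝ × ℝ) : ℝ :=
  ∑ i, loopLength m (C i)

/-- The integral of a one-form over a curve. -/
noncomputable def lineIntegral (η : ℝ × ℝ → (ℝ × ℝ →L[ℝ] ℝ)) (γ : ℝ → ℝ × ℝ) : ℝ :=
  ∫ t in (0 : ℝ)..1, η (γ t) (deriv γ t)

/-- The integral of a one-form over a finite family of curves. -/
noncomputable def cycleIntegral (η : ℝ × ℝ → (ℝ × ℝ →L[ℝ] ℝ)) {k : ℕ}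
    (C : Fin k → ℝ → ℝ × ℝ) : ℝ :=
  ∑ i, lineIntegral η (C i)

/-- The exterior derivative of `η = P dx + Q dy`, as the coefficient `∂Q/∂x - ∂P/∂y`
of `dx ∧ dy`. -/
noncomputable def extDer (η : ℝ × ℝ → (ℝ × ℝ →L[ℝ] ℝ)) (p : ℝ × ℝ) : ℝ :=
  fderiv ℝ η p (1, 0) (0, 1) - fderiv ℝ η p (0, 1) (1, 0)

/-- The circle `{r = ρ}`, traversed once counterclockwise. -/
noncomputable def circle (ρ : ℝ) (t : ℝ) : ℝ × ℝ :=
  (ρ * Real.cos (2 * Real.pi * t), ρ * Real.sin (2 * Real.pi * t))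

/-- The closed annulus `{3m ≤ r ≤ c}` between the photon sphere and the circle `{r = c}`. -/
def photonAnnulus (m c : ℝ) : Set (ℝ × ℝ) := {p | 3 * m ≤ radius p ∧ radius p ≤ c}

/-- Homology of cycles in the region `r > 2m`: every closed one-form of class `C¹` has the same
integral over both. (The first integral homology group of this region is `ℤ`, so this pairing
separates its classes.) -/
def Homologous (m : ℝ) {k l : ℕ} (C : Fin k → ℝ → ℝ × ℝ) (D : Fin l → ℝ → ℝ × ℝ) : Prop :=
  ∀ η : ℝ × ℝ → (ℝ × ℝ →L[ℝ] ℝ), ContDiffOn ℝ 1 η (exterior m) →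
    (∀ p ∈ exterior m, extDer η p = 0) → cycleIntegral η C = cycleIntegral η D

/-- The cycle `C` and the photon sphere `{r = 3m}` together bound the region consisting of `Sout`
outside the photon sphere and `Sin` inside it: as a chain,
`∂(Sout - Sin) = C - {r = 3m}`, that is, Stokes' formula holds for all one-forms of class `C¹`
on the region `r > 2m`. If `C` stays in `r ≥ 3m`, then `Sin` is a null set and this says that
`Sout` is the region between the photon sphere and `C`. -/
structure BoundWithPhotonSphere (m : ℝ) {k : ℕ} (C : Fin k → ℝ → ℝ × ℝ)
    (Sout Sin : Set (ℝ × ℝ)) : Prop where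
  measurable_out : MeasurableSet Sout
  measurable_in : MeasurableSet Sin
  compactly_contained : ∃ K : Set (ℝ × ℝ), IsCompact K ∧ K ⊆ exterior m ∧ Sout ⊆ K ∧ Sin ⊆ K
  out_subset : ∀ p ∈ Sout, 3 * m ≤ radius p
  in_subset : ∀ p ∈ Sin, radius p ≤ 3 * m
  stokes : ∀ η : ℝ × ℝ → (ℝ × ℝ →L[ℝ] ℝ), ContDiffOn ℝ 1 η (exterior m) →
    cycleIntegral η C - lineIntegral η (circle (3 * m))
      = (∫ p in Sout, extDer η p) - ∫ p in Sin, extDer η p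

/-- The competitors of the circle `{r = c}`: finite families of closed piecewise smooth curves,
homologous to `{r = c}`, which together with the photon sphere bound the same (net) area as
the annulus `{3m ≤ r ≤ c}`. -/
structure IsCompetitor (m c : ℝ) {k : ℕ} (C : Fin k → ℝ → ℝ × ℝ) : Prop where
  loop : ∀ i, IsLoop m (C i)
  homologous : Homologous m C ![circle c]
  area_eq : ∃ Sout Sin : Set (ℝ × ℝ), BoundWithPhotonSphere m C Sout Sin ∧
    area m Sout - area m Sin = area m (photonAnnulus m c)

end SchwarzschildOptical

/-! The problem is moved to the Euclidean plane by the map that keeps the angle `φ` and replaces `r`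
by `R = √(profile m r)`. Outside the photon sphere `R` is the optical circumference radius; inside,
where that radius grows again, `R` stays at its minimum `√27 m`. The map never increases length
(`stretch_speed_sq_le`) and preserves the length of circles with `r ≥ 3m`. Its pulled-back flat area
is the exterior derivative of `fluxForm m`, which is `½ R² dφ`.

Two estimates then meet. The flat isoperimetric inequality, applied to the image of each loop with
its algebraic area, gives `4π ∫ fluxForm ≤ length²` (`four_pi_mul_lineIntegral_fluxForm_le`). It
survives summation over the loops, because a sum of squares of nonnegative numbers is at most the
square of their sum. On the other side, flat area is `areaRatio m r` times optical area, and this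
ratio is nondecreasing in `r` and zero inside the photon sphere. At fixed net optical area the flat
area is therefore least for the annulus, by a bathtub argument (`setIntegral_extDer_fluxForm_le`),
so Stokes' formula yields `∫ fluxForm ≥ π · profile m c`. Together, `length² ≥ 4π² · profile m c`,
which is the squared length of the circle.

The flat inequality itself comes from Dido's inequality for the two halves of a closed curve, proved
by a calibration (`dido_inequality`). -/

open MeasureTheory Set

/-! ### Isoperimetric inequality for algebraic area in the flat plane -/

section PlaneCurves

open intervalIntegral

/-- Primitive of a function that is continuous at an interior point. -/
theorem hasDerivAt_primitive_of_mem_Ioo {a b t : ℝ} {v : ℝ → ℝ} (ht : t ∈ Ioo a b)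
    (hv : IntervalIntegrable v volume a b) (hvc : ContinuousAt v t) :
    HasDerivAt (fun τ => ∫ ξ in a..τ, v ξ) (v t) t := by
  have hab : a ≤ b := (ht.1.trans ht.2).le
  refine integral_hasDerivAt_right (hv.mono_set ?_) ?_ hvc
  · rw [uIcc_of_le ht.1.le, uIcc_of_le hab]
    exact Icc_subset_Icc_right ht.2.le
  · refine ⟨Ioc a b, Ioc_mem_nhds ht.1 ht.2, ?_⟩
    exact ((intervalIntegrable_iff_integrableOn_Ioc_of_le hab).1 hv).aestronglyMeasurable

/-- A monotone family of quadratic bounds: if `2 k A ≤ ℓ` for all `k ≥ 0` with `k ℓ < π`, then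
`2 π A ≤ ℓ ^ 2`. -/
theorem two_pi_mul_le_sq_of_forall {A l : ℝ} (hl : 0 ≤ l)
    (h : ∀ k : ℝ, 0 ≤ k → k * l < Real.pi → 2 * k * A ≤ l) : 2 * Real.pi * A ≤ l ^ 2 := by
  rcases hl.eq_or_lt with rfl | hl
  · have := h 1 (by norm_num) (by simpa using Real.pi_pos)
    nlinarith [Real.pi_pos]
  · by_contra! hlt
    have hA : 0 < A := by
      by_contra! hA
      nlinarith [Real.pi_pos, sq_pos_of_pos hl]
    -- This is the negated claim rearranged; any `k` in the gap is admissible and has `2 k A > l`.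
    have h1 : l / (2 * A) < Real.pi / l := by
      rw [div_lt_div_iff₀ (by positivity) hl]
      nlinarith
    obtain ⟨k, hk1, hk2⟩ := exists_between h1
    have hk0 : 0 < k := lt_trans (by positivity) hk1
    have := h k hk0.le (by rwa [lt_div_iff₀ hl] at hk2)
    rw [div_lt_iff₀ (by positivity)] at hk1
    linarith

/-- The added bracket is the derivative of `k y² tan θ` when `y' = q` and `θ' = k v`. With `z = k y
/ cos θ` and `w = p cos θ - q sin θ`, the difference of the two sides is `v (1 + z²) - 2 z w`, at
least `v (1 - |z|)²` since `|w| ≤ v`. The model for equality is `k y = cos θ`, a circle of radius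
`1/k`. -/
theorem two_mul_le_calibration {k y p q v θ : ℝ} (hv : 0 ≤ v) (hpq : p ^ 2 + q ^ 2 ≤ v ^ 2)
    (hθ : 0 < Real.cos θ) :
    2 * k * (y * p) ≤ v + (k * (2 * y * q) * Real.tan θ
      + k * y ^ 2 * (1 / Real.cos θ ^ 2 * (k * v))) := by
  have hcs : (p * Real.cos θ - q * Real.sin θ) ^ 2 ≤ v ^ 2 := by
    nlinarith [sq_nonneg (p * Real.sin θ + q * Real.cos θ), Real.sin_sq_add_cos_sq θ]
  have habs := abs_le_of_sq_le_sq' hcs hv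
  set z := k * y / Real.cos θ with hz
  have hky : k * y = z * Real.cos θ := by rw [hz]; field_simp
  have e : v + (k * (2 * y * q) * Real.tan θ + k * y ^ 2 * (1 / Real.cos θ ^ 2 * (k * v)))
      - 2 * k * (y * p) = v * (1 + z ^ 2) - 2 * z * (p * Real.cos θ - q * Real.sin θ) := by
    rw [Real.tan_eq_sin_div_cos, hz]
    field_simp
    ring
  have : 0 ≤ v * (1 + z ^ 2) - 2 * z * (p * Real.cos θ - q * Real.sin θ) := by
    rcases le_total 0 z with h | h
    · nlinarith [mul_nonneg hv (sq_nonneg (z - 1)), mul_nonneg h (sub_nonneg.2 habs.2)]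
    · nlinarith [mul_nonneg hv (sq_nonneg (z + 1)),
        mul_nonneg (neg_nonneg.2 h) (sub_nonneg.2 habs.1)]
  linarith

/-- Dido's inequality: an arc with end points on the axis `y = 0` encloses with it at most the
area of a half disc. Here `(p, q)` is the velocity of the arc and `v` bounds its speed. -/
theorem dido_inequality {a b : ℝ} (hab : a ≤ b) {N : Set ℝ} (hN : N.Countable)
    {y p q v : ℝ → ℝ} (hy : ContinuousOn y (Icc a b))
    (hyd : ∀ t ∈ Ioo a b \ N, HasDerivAt y (q t) t)
    (hvc : ∀ t ∈ Ioo a b \ N, ContinuousAt v t) (hv0 : ∀ t, 0 ≤ v t)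
    (hpq : ∀ t ∈ Ioo a b \ N, p t ^ 2 + q t ^ 2 ≤ v t ^ 2)
    (hp : IntervalIntegrable p volume a b) (hq : IntervalIntegrable q volume a b)
    (hv : IntervalIntegrable v volume a b) (ya : y a = 0) (yb : y b = 0) :
    2 * Real.pi * ∫ t in a..b, y t * p t ≤ (∫ t in a..b, v t) ^ 2 := by
  set s : ℝ → ℝ := fun τ => ∫ ξ in a..τ, v ξ with hs
  set l := s b with hl
  have hl0 : 0 ≤ l := integral_nonneg hab fun t _ => hv0 t
  have hy' : ContinuousOn y (uIcc a b) := by rwa [uIcc_of_le hab]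
  refine two_pi_mul_le_sq_of_forall hl0 fun k hk hkl => ?_
  have hsc : ContinuousOn s (Icc a b) := by
    have := continuousOn_primitive_interval' hv left_mem_uIcc
    rwa [uIcc_of_le hab] at this
  have hs0 : ∀ t ∈ Icc a b, 0 ≤ s t := fun t ht => integral_nonneg ht.1 fun t _ => hv0 t
  have hsl : ∀ t ∈ Icc a b, s t ≤ l := by
    intro t ht
    have h1 : IntervalIntegrable v volume a t := hv.mono_set (by
      rw [uIcc_of_le ht.1, uIcc_of_le hab]; exact Icc_subset_Icc_right ht.2)
    have h2 : IntervalIntegrable v volume t b := hv.mono_set (by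
      rw [uIcc_of_le ht.2, uIcc_of_le hab]; exact Icc_subset_Icc_left ht.1)
    have h3 := integral_add_adjacent_intervals h1 h2
    have h4 : 0 ≤ ∫ ξ in t..b, v ξ := integral_nonneg ht.2 fun t _ => hv0 t
    simp only [hs, hl]
    linarith
  -- The turning angle of a circle of radius `1/k`, measured from the midpoint of the arc. Since `k
  -- l < π` it stays inside `(-π/2, π/2)`, so `tan θ` is finite even at the end points.
  set θ : ℝ → ℝ := fun t => k * (s t - l / 2) with hθ
  have hθc : ContinuousOn θ (Icc a b) := continuousOn_const.mul (hsc.sub continuousOn_const)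
  have hcos : ∀ t ∈ Icc a b, 0 < Real.cos (θ t) := by
    intro t ht
    have := mul_nonneg hk (hs0 t ht)
    have := mul_le_mul_of_nonneg_left (hsl t ht) hk
    refine Real.cos_pos_of_mem_Ioo ⟨?_, ?_⟩ <;> simp only [hθ] <;> nlinarith
  have htan : ContinuousOn (fun t => Real.tan (θ t)) (Icc a b) := fun t ht =>
    (Real.continuousAt_tan.2 (hcos t ht).ne').comp_continuousWithinAt (hθc t ht)
  set g : ℝ → ℝ := fun t => k * (2 * y t * q t) * Real.tan (θ t)
    + k * y t ^ 2 * (1 / Real.cos (θ t) ^ 2 * (k * v t)) with hg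
  have hgi : IntervalIntegrable g volume a b := by
    have h1 : IntervalIntegrable (fun t => q t * (k * 2 * y t * Real.tan (θ t))) volume a b :=
      hq.mul_continuousOn (by
        rw [uIcc_of_le hab]; exact (continuousOn_const.mul hy).mul htan)
    have h2 : IntervalIntegrable
        (fun t => v t * (k * y t ^ 2 * (1 / Real.cos (θ t) ^ 2) * k)) volume a b :=
      hv.mul_continuousOn (by
        rw [uIcc_of_le hab]
        refine ((continuousOn_const.mul (hy.pow 2)).mul ?_).mul continuousOn_const
        exact continuousOn_const.div ((Real.continuous_cos.comp_continuousOn hθc).pow 2)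
          fun t ht => (pow_pos (hcos t ht) 2).ne')
    refine (h1.add h2).congr fun t _ => ?_
    simp only [hg]
    ring
  -- `g` is the derivative of `k y² tan θ`, which vanishes at both ends because `y` does.
  have hG : ∫ t in a..b, g t = 0 := by
    have := MeasureTheory.integral_eq_of_hasDerivAt_off_countable_of_le
      (fun t => k * y t ^ 2 * Real.tan (θ t)) g hab hN
      ((continuousOn_const.mul (hy.pow 2)).mul htan) (by
        intro t ht
        have hts : HasDerivAt s (v t) t := hasDerivAt_primitive_of_mem_Ioo ht.1 hv (hvc t ht)
        have htθ : HasDerivAt θ (k * v t) t := (hts.sub_const _).const_mul k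
        have := (((hyd t ht).pow 2).const_mul k).mul
          ((Real.hasDerivAt_tan (hcos t ⟨ht.1.1.le, ht.1.2.le⟩).ne').comp t htθ)
        refine this.congr_deriv ?_
        simp [hg]) hgi
    rw [this, ya, yb]
    simp
  have hyp : IntervalIntegrable (fun t => 2 * k * (y t * p t)) volume a b :=
    (hp.continuousOn_mul hy').const_mul _
  calc 2 * k * ∫ t in a..b, y t * p t = ∫ t in a..b, 2 * k * (y t * p t) := by
        rw [intervalIntegral.integral_const_mul]
    _ ≤ ∫ t in a..b, (v t + g t) := by
        refine intervalIntegral.integral_mono_ae_restrict hab hyp (hv.add hgi) ?_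
        have hae : ∀ᵐ t ∂volume.restrict (Icc a b), t ∉ N ∪ {a, b} :=
          ae_restrict_of_ae ((hN.union (Set.toFinite {a, b}).countable).ae_notMem _)
        filter_upwards [hae, ae_restrict_mem measurableSet_Icc] with t htN ht
        simp only [mem_union, mem_insert_iff, mem_singleton_iff, not_or] at htN
        have ht' : t ∈ Ioo a b \ N :=
          ⟨⟨lt_of_le_of_ne ht.1 (Ne.symm htN.2.1), lt_of_le_of_ne ht.2 htN.2.2⟩, htN.1⟩
        exact two_mul_le_calibration (hv0 t) (hpq t ht') (hcos t ht)
    _ = l := by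
        rw [intervalIntegral.integral_add hv hgi, hG, add_zero]

/-- The isoperimetric inequality for the algebraic area of a closed plane curve `(x, y)` with
speed bounded by `v`. -/
theorem planar_isoperimetric_inequality {N : Set ℝ} (hN : N.Countable)
    {x y p q v : ℝ → ℝ} (hx : ContinuousOn x (Icc 0 1)) (hy : ContinuousOn y (Icc 0 1))
    (hxd : ∀ t ∈ Ioo 0 1 \ N, HasDerivAt x (p t) t)
    (hyd : ∀ t ∈ Ioo 0 1 \ N, HasDerivAt y (q t) t)
    (hvc : ∀ t ∈ Ioo 0 1 \ N, ContinuousAt v t) (hv0 : ∀ t, 0 ≤ v t)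
    (hpq : ∀ t ∈ Ioo 0 1 \ N, p t ^ 2 + q t ^ 2 ≤ v t ^ 2)
    (hp : IntervalIntegrable p volume 0 1) (hq : IntervalIntegrable q volume 0 1)
    (hv : IntervalIntegrable v volume 0 1) (hx01 : x 0 = x 1) (hy01 : y 0 = y 1) :
    2 * Real.pi * ∫ t in (0 : ℝ)..1, (x t * q t - y t * p t) ≤ (∫ t in (0 : ℝ)..1, v t) ^ 2 := by
  have h01 : (0 : ℝ) ≤ 1 := zero_le_one
  set L := ∫ t in (0 : ℝ)..1, v t with hL
  have hL0 : 0 ≤ L := integral_nonneg h01 fun t _ => hv0 t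
  have hsc : ContinuousOn (fun τ => ∫ ξ in (0 : ℝ)..τ, v ξ) (Icc 0 1) := by
    have := continuousOn_primitive_interval' hv left_mem_uIcc
    rwa [uIcc_of_le h01] at this
  -- Halving the length makes the two Dido bounds add up sharply: `2 (L/2)² = L²/2`.
  obtain ⟨τ, hτ, hτL⟩ : ∃ τ ∈ Icc (0 : ℝ) 1, ∫ ξ in (0 : ℝ)..τ, v ξ = L / 2 := by
    have := intermediate_value_Icc h01 hsc
    exact this ⟨by simp; linarith, by simp only [← hL]; linarith⟩
  -- A unit vector along the chord between the two cutting points; any direction serves if they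
  -- coincide. In the rotated coordinates both arcs end on the axis `Y = 0`.
  obtain ⟨α, β, hαβ, hperp⟩ : ∃ α β : ℝ, α ^ 2 + β ^ 2 = 1 ∧
      α * (y τ - y 0) - β * (x τ - x 0) = 0 := by
    by_cases h : (x τ - x 0) ^ 2 + (y τ - y 0) ^ 2 = 0
    · refine ⟨1, 0, by norm_num, ?_⟩
      have : y τ - y 0 = 0 := by
        have : (y τ - y 0) ^ 2 = 0 := by nlinarith [sq_nonneg (x τ - x 0), sq_nonneg (y τ - y 0)]
        exact pow_eq_zero_iff (two_ne_zero) |>.1 this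
      rw [this]; ring
    · have hpos : 0 < (x τ - x 0) ^ 2 + (y τ - y 0) ^ 2 :=
        lt_of_le_of_ne (by positivity) (Ne.symm h)
      set d := Real.sqrt ((x τ - x 0) ^ 2 + (y τ - y 0) ^ 2) with hd
      have hd0 : 0 < d := Real.sqrt_pos.2 hpos
      have hdd : d ^ 2 = (x τ - x 0) ^ 2 + (y τ - y 0) ^ 2 := Real.sq_sqrt hpos.le
      refine ⟨(x τ - x 0) / d, (y τ - y 0) / d, ?_, by ring⟩
      rw [div_pow, div_pow, ← add_div, ← hdd, div_self (by positivity)]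
  set Y : ℝ → ℝ := fun t => α * (y t - y 0) - β * (x t - x 0) with hY
  set X : ℝ → ℝ := fun t => α * (x t - x 0) + β * (y t - y 0) with hX
  -- The sign makes `∫ Y P = -∮ Y dX`, the algebraic area counted positively for counterclockwise
  -- curves.
  set P : ℝ → ℝ := fun t => -(α * p t + β * q t) with hP
  set Q : ℝ → ℝ := fun t => α * q t - β * p t with hQ
  have hYc : ContinuousOn Y (Icc 0 1) :=
    (continuousOn_const.mul (hy.sub continuousOn_const)).sub
      (continuousOn_const.mul (hx.sub continuousOn_const))
  have hXc : ContinuousOn X (Icc 0 1) :=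
    (continuousOn_const.mul (hx.sub continuousOn_const)).add
      (continuousOn_const.mul (hy.sub continuousOn_const))
  have hYd : ∀ t ∈ Ioo 0 1 \ N, HasDerivAt Y (Q t) t := fun t ht =>
    (((hyd t ht).sub_const _).const_mul α).sub (((hxd t ht).sub_const _).const_mul β)
  have hXd : ∀ t ∈ Ioo 0 1 \ N, HasDerivAt X (-P t) t := fun t ht =>
    ((((hxd t ht).sub_const _).const_mul α).add (((hyd t ht).sub_const _).const_mul β)).congr_deriv
      (by simp [hP])
  have hPi : IntervalIntegrable P volume 0 1 := ((hp.const_mul α).add (hq.const_mul β)).neg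
  have hQi : IntervalIntegrable Q volume 0 1 := (hq.const_mul α).sub (hp.const_mul β)
  have hPQ : ∀ t ∈ Ioo 0 1 \ N, P t ^ 2 + Q t ^ 2 ≤ v t ^ 2 := by
    intro t ht
    have : P t ^ 2 + Q t ^ 2 = (α ^ 2 + β ^ 2) * (p t ^ 2 + q t ^ 2) := by
      simp only [hP, hQ]; ring
    rw [this, hαβ, one_mul]
    exact hpq t ht
  have hs1 : uIcc 0 τ ⊆ uIcc (0 : ℝ) 1 := by
    rw [uIcc_of_le hτ.1, uIcc_of_le h01]; exact Icc_subset_Icc_right hτ.2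
  have hs2 : uIcc τ 1 ⊆ uIcc (0 : ℝ) 1 := by
    rw [uIcc_of_le hτ.2, uIcc_of_le h01]; exact Icc_subset_Icc_left hτ.1
  have hi1 : Ioo 0 τ \ N ⊆ Ioo 0 1 \ N := sdiff_subset_sdiff_left (Ioo_subset_Ioo_right hτ.2)
  have hi2 : Ioo τ 1 \ N ⊆ Ioo 0 1 \ N := sdiff_subset_sdiff_left (Ioo_subset_Ioo_left hτ.1)
  have Y0 : Y 0 = 0 := by simp [hY]
  have Y1 : Y 1 = 0 := by simp [hY, hx01, hy01]
  have d1 := dido_inequality hτ.1 hN (hYc.mono (Icc_subset_Icc_right hτ.2))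
    (fun t ht => hYd t (hi1 ht)) (fun t ht => hvc t (hi1 ht)) hv0
    (fun t ht => hPQ t (hi1 ht)) (hPi.mono_set hs1) (hQi.mono_set hs1) (hv.mono_set hs1) Y0 hperp
  have d2 := dido_inequality hτ.2 hN (hYc.mono (Icc_subset_Icc_left hτ.1))
    (fun t ht => hYd t (hi2 ht)) (fun t ht => hvc t (hi2 ht)) hv0
    (fun t ht => hPQ t (hi2 ht)) (hPi.mono_set hs2) (hQi.mono_set hs2) (hv.mono_set hs2) hperp Y1
  have hYP : IntervalIntegrable (fun t => Y t * P t) volume 0 1 :=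
    hPi.continuousOn_mul (by rwa [uIcc_of_le h01])
  have hXQ : IntervalIntegrable (fun t => X t * Q t) volume 0 1 :=
    hQi.continuousOn_mul (by rwa [uIcc_of_le h01])
  have esum := integral_add_adjacent_intervals (hYP.mono_set hs1) (hYP.mono_set hs2)
  have vsum := integral_add_adjacent_intervals (hv.mono_set hs1) (hv.mono_set hs2)
  have hv2 : ∫ t in τ..1, v t = L / 2 := by linarith
  rw [hτL] at d1
  rw [hv2] at d2
  -- The integrand is the derivative of `X Y`, since `X' = -P`.
  have hXY : ∫ t in (0 : ℝ)..1, (X t * Q t - Y t * P t) = 0 := by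
    have := MeasureTheory.integral_eq_of_hasDerivAt_off_countable_of_le
      (fun t => X t * Y t) (fun t => X t * Q t - Y t * P t) h01 hN (hXc.mul hYc)
      (fun t ht => ((hXd t ht).mul (hYd t ht)).congr_deriv (by ring)) (hXQ.sub hYP)
    rw [this, Y0, Y1]; ring
  have hp0 : ∫ t in (0 : ℝ)..1, p t = 0 := by
    rw [MeasureTheory.integral_eq_of_hasDerivAt_off_countable_of_le x p h01 hN hx hxd hp, hx01,
      sub_self]
  have hq0 : ∫ t in (0 : ℝ)..1, q t = 0 := by
    rw [MeasureTheory.integral_eq_of_hasDerivAt_off_countable_of_le y q h01 hN hy hyd hq, hy01,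
      sub_self]
  have key : ∀ t, x t * q t - y t * p t
      = ((X t * Q t - Y t * P t) + 2 * (Y t * P t)) + (x 0 * q t - y 0 * p t) := by
    intro t
    have : x t * q t - y t * p t = (α ^ 2 + β ^ 2) * ((x t - x 0) * q t - (y t - y 0) * p t)
        + (x 0 * q t - y 0 * p t) := by rw [hαβ]; ring
    rw [this]
    simp only [hX, hY, hP, hQ]
    ring
  have harea : ∫ t in (0 : ℝ)..1, (x t * q t - y t * p t) = 2 * ∫ t in (0 : ℝ)..1, Y t * P t := by
    simp_rw [key]
    rw [intervalIntegral.integral_add ((hXQ.sub hYP).add (hYP.const_mul 2))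
      ((hq.const_mul _).sub (hp.const_mul _)),
      intervalIntegral.integral_add (hXQ.sub hYP) (hYP.const_mul 2), hXY,
      intervalIntegral.integral_sub (hq.const_mul _) (hp.const_mul _),
      intervalIntegral.integral_const_mul, intervalIntegral.integral_const_mul,
      intervalIntegral.integral_const_mul, hp0, hq0]
    ring
  rw [harea, ← esum]
  linear_combination 2 * d1 + 2 * d2

end PlaneCurves

/-! ### Regularity of integrands along piecewise smooth loops -/

/-- On a smooth arc, a continuous function of position and velocity is integrable. -/
theorem intervalIntegrable_comp_deriv_of_contDiffOn {E : Type*} [NormedAddCommGroup E]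
    [NormedSpace ℝ E] {U : Set E} {Φ : E × E → ℝ} (hΦ : ContinuousOn Φ (U ×ˢ univ))
    {γ : ℝ → E} {a b : ℝ} (hab : a ≤ b) (hγ : ContDiffOn ℝ ∞ γ (Icc a b))
    (hU : ∀ t ∈ Icc a b, γ t ∈ U) :
    IntervalIntegrable (fun t => Φ (γ t, deriv γ t)) volume a b := by
  rcases hab.eq_or_lt with rfl | hab'
  · exact IntervalIntegrable.refl
  have hd : ContinuousOn (derivWithin γ (Icc a b)) (Icc a b) :=
    hγ.continuousOn_derivWithin (uniqueDiffOn_Icc hab') (by simp)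
  have hc : ContinuousOn (fun t => Φ (γ t, derivWithin γ (Icc a b) t)) (Icc a b) :=
    hΦ.comp (hγ.continuousOn.prodMk hd) fun t ht => ⟨hU t ht, mem_univ _⟩
  have hi : IntervalIntegrable (fun t => Φ (γ t, derivWithin γ (Icc a b) t)) volume a b :=
    (by rwa [uIcc_of_le hab] : ContinuousOn _ (uIcc a b)).intervalIntegrable
  refine hi.congr_ae ?_
  have hae : ∀ᵐ t ∂volume.restrict (uIoc a b), t ∉ ({b} : Set ℝ) :=
    ae_restrict_of_ae ((countable_singleton b).ae_notMem _)
  filter_upwards [hae, ae_restrict_mem measurableSet_uIoc] with t htb ht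
  rw [uIoc_of_le hab] at ht
  rw [derivWithin_of_mem_nhds (Icc_mem_nhds ht.1 (lt_of_le_of_ne ht.2 htb))]

namespace SchwarzschildOptical

variable {m : ℝ} {γ : ℝ → ℝ × ℝ}

theorem IsLoop.intervalIntegrable_comp_deriv (h : IsLoop m γ) {Φ : (ℝ × ℝ) × (ℝ × ℝ) → ℝ}
    (hΦ : ContinuousOn Φ (exterior m ×ˢ univ)) :
    IntervalIntegrable (fun t => Φ (γ t, deriv γ t)) volume 0 1 := by
  obtain ⟨n, t, hmono, h0, h1, hsm⟩ := h.piecewise_smooth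
  have hn : ∀ j (hj : j ≤ n), t ⟨j, Nat.lt_succ_of_le hj⟩ ∈ Icc (0 : ℝ) 1 := fun j hj =>
    ⟨h0 ▸ hmono (Fin.zero_le _), h1 ▸ hmono (Fin.le_last _)⟩
  have key : ∀ j (hj : j ≤ n), IntervalIntegrable (fun t => Φ (γ t, deriv γ t)) volume 0
      (t ⟨j, Nat.lt_succ_of_le hj⟩) := by
    intro j
    induction j with
    | zero =>
      intro hj
      have : t ⟨0, Nat.lt_succ_of_le hj⟩ = 0 := h0
      rw [this]
    | succ j ih =>
      intro hj
      refine (ih (Nat.le_of_succ_le hj)).trans ?_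
      refine intervalIntegrable_comp_deriv_of_contDiffOn hΦ
        (hmono (Fin.mk_le_mk.2 (Nat.le_succ j))) (hsm ⟨j, hj⟩) fun τ hτ => ?_
      exact h.mem τ ⟨(hn j (Nat.le_of_succ_le hj)).1.trans hτ.1, hτ.2.trans (hn _ hj).2⟩
  have := key n le_rfl
  rwa [show t ⟨n, Nat.lt_succ_of_le le_rfl⟩ = 1 from h1] at this

theorem IsLoop.exists_countable_contDiffAt (h : IsLoop m γ) :
    ∃ N : Set ℝ, N.Countable ∧ ∀ t ∈ Ioo 0 1 \ N, ContDiffAt ℝ ∞ γ t := by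
  obtain ⟨n, t, hmono, h0, h1, hsm⟩ := h.piecewise_smooth
  refine ⟨range t, countable_range t, fun τ hτ => ?_⟩
  have key : ∀ j (hj : j ≤ n), τ < t ⟨j, Nat.lt_succ_of_le hj⟩ → ContDiffAt ℝ ∞ γ τ := by
    intro j
    induction j with
    | zero =>
      intro hj hlt
      have : t ⟨0, Nat.lt_succ_of_le hj⟩ = 0 := h0
      exact absurd (this ▸ hlt) (not_lt.2 hτ.1.1.le)
    | succ j ih =>
      intro hj hlt
      rcases lt_trichotomy τ (t ⟨j, Nat.lt_succ_of_le (Nat.le_of_succ_le hj)⟩) with hl | he | hg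
      · exact ih (Nat.le_of_succ_le hj) hl
      · exact absurd ⟨_, he.symm⟩ hτ.2
      · exact (hsm ⟨j, hj⟩).contDiffAt (Icc_mem_nhds hg hlt)
  refine key n le_rfl ?_
  rw [show t ⟨n, Nat.lt_succ_of_le le_rfl⟩ = 1 from h1]
  exact hτ.1.2

theorem isOpen_exterior (m : ℝ) : IsOpen (exterior m) := by
  refine isOpen_lt continuous_const ?_
  unfold radius
  fun_prop

/-- Away from the break points, a continuous function of position and velocity is continuous
along a loop. -/
theorem continuousAt_comp_deriv {Φ : (ℝ × ℝ) × (ℝ × ℝ) → ℝ}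
    (hΦ : ContinuousOn Φ (exterior m ×ˢ univ)) {t : ℝ} (ht : γ t ∈ exterior m)
    (hγ : ContDiffAt ℝ ∞ γ t) : ContinuousAt (fun t => Φ (γ t, deriv γ t)) t := by
  have h1 : ContinuousAt (deriv γ) t := by
    have := hγ.fderiv_right (m := 0) (by simp)
    exact (this.continuousAt.clm_apply continuousAt_const)
  have h2 : ContinuousAt Φ (γ t, deriv γ t) :=
    hΦ.continuousAt (((isOpen_exterior m).prod isOpen_univ).mem_nhds ⟨ht, mem_univ _⟩)
  exact ContinuousAt.comp (f := fun t => (γ t, deriv γ t)) h2 (hγ.continuousAt.prodMk h1)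

/-! ### Polar coordinates and Stokes' theorem on annuli -/

/-- The vector `∂/∂φ` at the point with polar coordinates `q`. -/
noncomputable def angularVector (q : ℝ × ℝ) : ℝ × ℝ :=
  (-(q.1 * Real.sin q.2), q.1 * Real.cos q.2)

/-- The vector `∂/∂r` at the point with polar coordinates `q`. -/
noncomputable def radialVector (q : ℝ × ℝ) : ℝ × ℝ := (Real.cos q.2, Real.sin q.2)

theorem radius_polarCoord_symm (q : ℝ × ℝ) : radius (polarCoord.symm q) = |q.1| := by
  simp only [radius, polarCoord_symm_apply]
  rw [← Real.sqrt_sq_eq_abs]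
  congr 1
  nlinarith [Real.sin_sq_add_cos_sq q.2]

theorem continuous_radius : Continuous radius := by
  unfold radius
  fun_prop

theorem circle_eq_polarCoord_symm (ρ t : ℝ) :
    circle ρ t = polarCoord.symm (ρ, 2 * Real.pi * t) := rfl

theorem radius_circle {ρ : ℝ} (hρ : 0 ≤ ρ) (t : ℝ) : radius (circle ρ t) = ρ := by
  rw [circle_eq_polarCoord_symm, radius_polarCoord_symm, abs_of_nonneg hρ]

theorem deriv_circle (ρ t : ℝ) :
    deriv (circle ρ) t = (2 * Real.pi) • angularVector (ρ, 2 * Real.pi * t) := by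
  have h : HasDerivAt (fun t : ℝ => 2 * Real.pi * t) (2 * Real.pi) t := by
    simpa using (hasDerivAt_id t).const_mul (2 * Real.pi)
  have := (h.cos.const_mul ρ).prodMk (h.sin.const_mul ρ)
  have e : deriv (circle ρ) t = _ := this.deriv
  rw [e]
  simp only [angularVector, Prod.smul_mk, smul_eq_mul, Prod.mk.injEq]
  constructor <;> ring

/-- The `r`-derivative recorded here equals the `φ`-derivative of `radialVector`, both being the
mixed second derivative of the polar map. This makes the zeroth-order terms cancel in Stokes'
theorem. -/
theorem hasFDerivAt_angularVector (q : ℝ × ℝ) :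
    ∃ A : ℝ × ℝ →L[ℝ] ℝ × ℝ, HasFDerivAt angularVector A q ∧
      A (1, 0) = (-Real.sin q.2, Real.cos q.2) := by
  refine ⟨_, (((hasFDerivAt_fst (𝕜 := ℝ) (p := q)).mul
    (hasFDerivAt_snd (𝕜 := ℝ) (p := q)).sin).neg.prodMk
    ((hasFDerivAt_fst (𝕜 := ℝ) (p := q)).mul (hasFDerivAt_snd (𝕜 := ℝ) (p := q)).cos)), ?_⟩
  simp

theorem hasFDerivAt_radialVector (q : ℝ × ℝ) :
    ∃ A : ℝ × ℝ →L[ℝ] ℝ × ℝ, HasFDerivAt radialVector A q ∧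
      A (0, 1) = (-Real.sin q.2, Real.cos q.2) := by
  refine ⟨_, ((hasFDerivAt_snd (𝕜 := ℝ) (p := q)).cos.prodMk
    (hasFDerivAt_snd (𝕜 := ℝ) (p := q)).sin), ?_⟩
  simp

theorem fderivPolarCoordSymm_apply (q v : ℝ × ℝ) :
    fderivPolarCoordSymm q v = (Real.cos q.2 * v.1 - q.1 * Real.sin q.2 * v.2,
      Real.sin q.2 * v.1 + q.1 * Real.cos q.2 * v.2) := by
  unfold fderivPolarCoordSymm
  rw [Matrix.toLin_finTwoProd_toContinuousLinearMap]
  simp [sub_eq_add_neg]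

theorem lineIntegral_circle (η : ℝ × ℝ → (ℝ × ℝ →L[ℝ] ℝ)) (ρ : ℝ) :
    lineIntegral η (circle ρ) = ∫ φ in -Real.pi..Real.pi,
      η (polarCoord.symm (ρ, φ)) (angularVector (ρ, φ)) := by
  set f : ℝ → ℝ := fun φ => η (polarCoord.symm (ρ, φ)) (angularVector (ρ, φ)) with hf
  have hper : Function.Periodic f (2 * Real.pi) := by
    intro φ
    simp only [hf, polarCoord_symm_apply, angularVector, Real.cos_add_two_pi,
      Real.sin_add_two_pi]
  have h1 : lineIntegral η (circle ρ) = ∫ t in (0 : ℝ)..1, 2 * Real.pi * f (2 * Real.pi * t) := by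
    unfold lineIntegral
    simp only [deriv_circle, circle_eq_polarCoord_symm, map_smul, smul_eq_mul, hf]
  rw [h1, intervalIntegral.integral_const_mul, intervalIntegral.mul_integral_comp_mul_left]
  have := hper.intervalIntegral_add_eq 0 (-Real.pi)
  rw [show -Real.pi + 2 * Real.pi = Real.pi by ring, zero_add] at this
  simpa using this

theorem map_pair_sub_map_pair (A : ℝ × ℝ →L[ℝ] ℝ × ℝ →L[ℝ] ℝ) (u v : ℝ × ℝ) :
    A u v - A v u = (u.1 * v.2 - u.2 * v.1) * (A (1, 0) (0, 1) - A (0, 1) (1, 0)) := by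
  have e : ∀ w : ℝ × ℝ, w = w.1 • ((1 : ℝ), (0 : ℝ)) + w.2 • ((0 : ℝ), (1 : ℝ)) := fun w => by
    ext <;> simp
  conv_lhs => rw [e u, e v]
  simp only [map_add, map_smul, add_apply, smul_apply,
    smul_eq_mul]
  ring

theorem continuousOn_extDer {U : Set (ℝ × ℝ)} (hU : IsOpen U)
    {η : ℝ × ℝ → (ℝ × ℝ →L[ℝ] ℝ)} (hη : ContDiffOn ℝ 1 η U) : ContinuousOn (extDer η) U := by
  have h := hη.continuousOn_fderiv_of_isOpen hU le_rfl
  unfold extDer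
  exact ((h.clm_apply continuousOn_const).clm_apply continuousOn_const).sub
    ((h.clm_apply continuousOn_const).clm_apply continuousOn_const)

/-- Stokes' theorem on a round annulus. -/
theorem lineIntegral_circle_sub_lineIntegral_circle {U : Set (ℝ × ℝ)} (hU : IsOpen U)
    {η : ℝ × ℝ → (ℝ × ℝ →L[ℝ] ℝ)} (hη : ContDiffOn ℝ 1 η U) {a b : ℝ} (ha : 0 < a) (hab : a ≤ b)
    (hsub : {p | a ≤ radius p ∧ radius p ≤ b} ⊆ U) :
    lineIntegral η (circle b) - lineIntegral η (circle a)
      = ∫ p in {p | a ≤ radius p ∧ radius p ≤ b}, extDer η p := by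
  have hpi : -Real.pi ≤ Real.pi := by linarith [Real.pi_pos]
  set R : Set (ℝ × ℝ) := Icc (a, -Real.pi) (b, Real.pi) with hR
  have hmem : ∀ q ∈ R, polarCoord.symm q ∈ U := by
    intro q hq
    refine hsub ?_
    have h1 : a ≤ q.1 := hq.1.1
    have h2 : q.1 ≤ b := hq.2.1
    simp only [mem_ofPred_eq, radius_polarCoord_symm, abs_of_pos (ha.trans_le h1)]
    exact ⟨h1, h2⟩
  have hmaps : MapsTo polarCoord.symm R U := hmem
  have hpc := continuous_polarCoord_symm
  have hav : Continuous angularVector := by unfold angularVector; fun_prop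
  have hrv : Continuous radialVector := by unfold radialVector; fun_prop
  have hηc : ContinuousOn (fun q => η (polarCoord.symm q)) R :=
    hη.continuousOn.comp hpc.continuousOn hmaps
  have hdη : ∀ q ∈ R, HasFDerivAt (fun q => η (polarCoord.symm q))
      ((fderiv ℝ η (polarCoord.symm q)).comp (fderivPolarCoordSymm q)) q := fun q hq =>
    (((hη.differentiableOn one_ne_zero).differentiableAt
      (hU.mem_nhds (hmem q hq))).hasFDerivAt).comp q (hasFDerivAt_polarCoord_symm q)
  choose A hA hA1 using hasFDerivAt_angularVector
  choose B hB hB1 using hasFDerivAt_radialVector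
  set f' : ℝ × ℝ → ℝ × ℝ →L[ℝ] ℝ := fun q => (η (polarCoord.symm q)).comp (A q) +
    (((fderiv ℝ η (polarCoord.symm q)).comp (fderivPolarCoordSymm q)).flip (angularVector q))
    with hf'
  set g' : ℝ × ℝ → ℝ × ℝ →L[ℝ] ℝ := fun q => -((η (polarCoord.symm q)).comp (B q) +
    (((fderiv ℝ η (polarCoord.symm q)).comp (fderivPolarCoordSymm q)).flip (radialVector q)))
    with hg'
  have hIoo : Ioo a b ×ˢ Ioo (-Real.pi) Real.pi ⊆ R := by
    rw [hR, Icc_prod_eq]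
    exact prod_mono Ioo_subset_Icc_self Ioo_subset_Icc_self
  -- The field `(η(∂/∂φ), -η(∂/∂r))` has as divergence the pulled-back exterior derivative:
  -- mixed-derivative terms cancel, and the Jacobian leaves the factor `r`.
  have hdiv : ∀ q, f' q (1, 0) + g' q (0, 1) = q.1 * extDer η (polarCoord.symm q) := by
    intro q
    have hr : fderivPolarCoordSymm q (1, 0) = radialVector q := by
      rw [fderivPolarCoordSymm_apply]; simp [radialVector]
    have ha' : fderivPolarCoordSymm q (0, 1) = angularVector q := by
      rw [fderivPolarCoordSymm_apply]; simp [angularVector]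
    simp only [hf', hg', add_apply, neg_apply,
      ContinuousLinearMap.comp_apply, ContinuousLinearMap.flip_apply, hA1, hB1, hr, ha']
    have := map_pair_sub_map_pair (fderiv ℝ η (polarCoord.symm q)) (radialVector q)
      (angularVector q)
    have e : (radialVector q).1 * (angularVector q).2 - (radialVector q).2 * (angularVector q).1
        = q.1 := by
      simp only [radialVector, angularVector]
      linear_combination q.1 * Real.sin_sq_add_cos_sq q.2
    rw [e] at this
    rw [extDer]
    linarith
  have hext : ContinuousOn (fun q : ℝ × ℝ => q.1 * extDer η (polarCoord.symm q)) R :=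
    continuousOn_fst.mul ((continuousOn_extDer hU hη).comp hpc.continuousOn hmaps)
  have hcomp : IsCompact R := isCompact_Icc
  have key := integral_divergence_prod_Icc_of_hasFDerivAt_of_le
    (fun q => η (polarCoord.symm q) (angularVector q))
    (fun q => -(η (polarCoord.symm q) (radialVector q))) f' g' (a, -Real.pi) (b, Real.pi)
    ⟨hab, hpi⟩ (hηc.clm_apply hav.continuousOn) (hηc.clm_apply hrv.continuousOn).neg
    (fun q hq => (hdη q (hIoo hq)).clm_apply (hA q))
    (fun q hq => ((hdη q (hIoo hq)).clm_apply (hB q)).neg)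
    (by
      simp only [hdiv]
      exact hext.integrableOn_compact hcomp)
  simp only [hdiv] at key
  -- The edges `φ = ±π` of the rectangle are the same slit, so their boundary terms cancel.
  have hends : ∀ r : ℝ, polarCoord.symm (r, -Real.pi) = polarCoord.symm (r, Real.pi) ∧
      radialVector (r, -Real.pi) = radialVector (r, Real.pi) := by
    intro r
    simp [polarCoord_symm_apply, radialVector]
  simp only [(hends _).1, (hends _).2, sub_self, zero_add] at key
  rw [lineIntegral_circle, lineIntegral_circle, ← key]
  set S : Set (ℝ × ℝ) := {p | a ≤ radius p ∧ radius p ≤ b} with hS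
  have hSm : MeasurableSet S :=
    (measurableSet_le measurable_const continuous_radius.measurable).inter
      (measurableSet_le continuous_radius.measurable measurable_const)
  rw [← integral_indicator hSm, ← integral_comp_polarCoord_symm]
  have hTm : MeasurableSet polarCoord.target := polarCoord.open_target.measurableSet
  have e1 : ∀ q ∈ polarCoord.target, q.1 • S.indicator (extDer η) (polarCoord.symm q)
      = (Icc a b ×ˢ Ioo (-Real.pi) Real.pi).indicator
        (fun q => q.1 * extDer η (polarCoord.symm q)) q := by
    intro q hq
    have hq1 : 0 < q.1 := hq.1
    have hiff : polarCoord.symm q ∈ S ↔ q ∈ Icc a b ×ˢ Ioo (-Real.pi) Real.pi := by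
      simp only [hS, mem_ofPred_eq, radius_polarCoord_symm, abs_of_pos hq1]
      exact ⟨fun h => ⟨h, hq.2⟩, fun h => h.1⟩
    by_cases h : q ∈ Icc a b ×ˢ Ioo (-Real.pi) Real.pi
    · rw [indicator_of_mem h, indicator_of_mem (hiff.2 h), smul_eq_mul]
    · rw [indicator_of_notMem h, indicator_of_notMem (fun h' => h (hiff.1 h')), smul_zero]
  have hIm : MeasurableSet (Icc a b ×ˢ Ioo (-Real.pi) Real.pi) :=
    measurableSet_Icc.prod measurableSet_Ioo
  have hIT : Icc a b ×ˢ Ioo (-Real.pi) Real.pi ⊆ polarCoord.target := by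
    rintro q ⟨h1, h2⟩
    exact ⟨ha.trans_le h1.1, h2⟩
  rw [setIntegral_congr_fun hTm e1, setIntegral_indicator hIm, inter_eq_self_of_subset_right hIT,
    Icc_prod_eq]
  refine setIntegral_congr_set ?_
  exact Measure.set_prod_ae_eq (Filter.EventuallyEq.refl _ _) Ioo_ae_eq_Icc.symm

end SchwarzschildOptical

/-! ### The truncated squared circumference radius and the area ratio -/

theorem hasDerivAt_max_zero_sq (t : ℝ) : HasDerivAt (fun t : ℝ => max t 0 ^ 2) (2 * max t 0) t := by
  rcases lt_trichotomy t 0 with h | rfl | h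
  · have : (fun t : ℝ => max t 0 ^ 2) =ᶠ[nhds t] fun _ => 0 := by
      filter_upwards [gt_mem_nhds h] with s hs
      rw [max_eq_right hs.le]; norm_num
    rw [max_eq_right h.le, mul_zero]
    exact (hasDerivAt_const t (0 : ℝ)).congr_of_eventuallyEq this
  · rw [max_self, mul_zero, hasDerivAt_iff_isLittleO_nhds_zero]
    have h1 : (fun h : ℝ => max (0 + h) 0 ^ 2 - max (0 : ℝ) 0 ^ 2 - h • (0 : ℝ))
        =O[nhds 0] fun h => h ^ 2 := by
      refine Asymptotics.isBigO_of_le _ fun h => ?_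
      simp only [zero_add, max_self, smul_zero, sub_zero, Real.norm_eq_abs]
      rcases le_total h 0 with h0 | h0 <;> simp [h0, sq_nonneg]
    exact h1.trans_isLittleO (Asymptotics.isLittleO_pow_id one_lt_two)
  · have : (fun t : ℝ => max t 0 ^ 2) =ᶠ[nhds t] fun t => t ^ 2 := by
      filter_upwards [lt_mem_nhds h] with s hs
      rw [max_eq_left hs.le]
    rw [max_eq_left h.le]
    simpa using (hasDerivAt_pow 2 t).congr_of_eventuallyEq this

theorem contDiff_max_zero_sq : ContDiff ℝ 1 fun t : ℝ => max t 0 ^ 2 := by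
  rw [contDiff_one_iff_deriv]
  refine ⟨fun t => (hasDerivAt_max_zero_sq t).differentiableAt, ?_⟩
  rw [show deriv (fun t : ℝ => max t 0 ^ 2) = fun t => 2 * max t 0 from
    funext fun t => (hasDerivAt_max_zero_sq t).deriv]
  fun_prop

namespace SchwarzschildOptical

/-- The squared circumference radius `r² / (1 - 2m/r)` of the circle of radius `r`, continued by
its minimum inside the photon sphere. -/
noncomputable def profile (m r : ℝ) : ℝ :=
  27 * m ^ 2 + max (r - 3 * m) 0 ^ 2 * ((r + 6 * m) / (r - 2 * m))

/-- The derivative of `profile m`. -/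
noncomputable def profileDeriv (m r : ℝ) : ℝ :=
  2 * r ^ 2 * max (r - 3 * m) 0 / (r - 2 * m) ^ 2

variable {m r : ℝ}

theorem hasDerivAt_profile (hr : 2 * m < r) : HasDerivAt (profile m) (profileDeriv m r) r := by
  have hx : r - 2 * m ≠ 0 := by linarith
  have h1 : HasDerivAt (fun r => max (r - 3 * m) 0 ^ 2) (2 * max (r - 3 * m) 0) r := by
    have := (hasDerivAt_max_zero_sq (r - 3 * m)).comp r ((hasDerivAt_id r).sub_const (3 * m))
    simpa [Function.comp_def] using this
  have h2 : HasDerivAt (fun r => (r + 6 * m) / (r - 2 * m))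
      ((1 * (r - 2 * m) - (r + 6 * m) * 1) / (r - 2 * m) ^ 2) r :=
    ((hasDerivAt_id r).add_const _).div ((hasDerivAt_id r).sub_const _) hx
  refine ((h1.mul h2).const_add (27 * m ^ 2)).congr_deriv ?_
  unfold profileDeriv
  rcases le_total (r - 3 * m) 0 with h | h
  · simp [max_eq_right h]
  · rw [max_eq_left h]
    field_simp
    ring

/-- The identity `r³ - 27m²(r - 2m) = (r - 3m)²(r + 6m)`. Its double zero at the photon sphere is
why truncation leaves `profile` of class `C¹`, as the Stokes condition on competitors requires of
its test forms. -/
theorem profile_eq_of_le (hm : 0 < m) (hr : 3 * m ≤ r) : profile m r = r ^ 3 / (r - 2 * m) := by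
  have hx : r - 2 * m ≠ 0 := by linarith
  rw [profile, max_eq_left (by linarith), eq_div_iff hx]
  linear_combination (r - 3 * m) ^ 2 * div_mul_cancel₀ (r + 6 * m) hx

theorem profile_pos (hm : 0 < m) (hr : 2 * m < r) : 0 < profile m r := by
  have : 0 < r - 2 * m := by linarith
  have : 0 < r + 6 * m := by linarith
  unfold profile
  positivity

theorem profile_le (hm : 0 < m) (hr : 2 * m < r) :
    profile m r ≤ r ^ 2 / (1 - 2 * m / r) := by
  have hx : 0 < r - 2 * m := by linarith
  have hr0 : 0 < r := by linarith
  have e : r ^ 2 / (1 - 2 * m / r) = r ^ 3 / (r - 2 * m) := by field_simp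
  rw [e]
  rcases le_total (3 * m) r with h | h
  · exact (profile_eq_of_le hm h).le
  · rw [profile, max_eq_right (by linarith), le_div_iff₀ hx]
    nlinarith [mul_nonneg (sq_nonneg (r - 3 * m)) (by linarith : 0 ≤ r + 6 * m)]

/-- The left side is the squared derivative of `√(profile m r)`, so this is contraction in the
radial direction; `profile_le` is its angular counterpart. -/
theorem profileDeriv_sq_le (hm : 0 < m) (hr : 2 * m < r) :
    profileDeriv m r ^ 2 / (4 * profile m r) ≤ 1 / (1 - 2 * m / r) ^ 2 := by
  have hx : 0 < r - 2 * m := by linarith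
  have hr0 : 0 < r := by linarith
  rcases le_total (3 * m) r with h | h
  · have e : 1 / (1 - 2 * m / r) ^ 2 = r ^ 2 / (r - 2 * m) ^ 2 := by field_simp
    have e' : profileDeriv m r ^ 2 / (4 * profile m r)
        = r * (r - 3 * m) ^ 2 / (r - 2 * m) ^ 3 := by
      rw [profile_eq_of_le hm h, profileDeriv, max_eq_left (by linarith)]
      field_simp
      ring
    rw [e, e', div_le_div_iff₀ (by positivity) (by positivity)]
    -- Equivalent to `9m² ≤ 4mr`, true since `r ≥ 3m`.
    have h1 : (r - 3 * m) ^ 2 ≤ r * (r - 2 * m) := by nlinarith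
    have : r * (r - 2 * m) ^ 2 * (r - 3 * m) ^ 2 ≤ r * (r - 2 * m) ^ 2 * (r * (r - 2 * m)) :=
      mul_le_mul_of_nonneg_left h1 (by positivity)
    nlinarith
  · rw [profileDeriv, max_eq_right (by linarith)]
    simp only [mul_zero, zero_div, ne_eq, OfNat.ofNat_ne_zero, not_false_eq_true, zero_pow]
    positivity

/-- The ratio of the flat area of the image of `(√(profile m r), φ)` to the optical area. -/
noncomputable def areaRatio (m r : ℝ) : ℝ := max (r - 3 * m) 0 / √(r * (r - 2 * m))

theorem areaRatio_mono (hm : 0 < m) {r s : ℝ} (hr : 2 * m < r) (hrs : r ≤ s) :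
    areaRatio m r ≤ areaRatio m s := by
  unfold areaRatio
  rcases le_total r (3 * m) with h | h
  · rw [max_eq_right (by linarith), zero_div]
    positivity
  · have h1 : 0 < r * (r - 2 * m) := mul_pos (by linarith) (by linarith)
    have h2 : 0 < s * (s - 2 * m) := mul_pos (by linarith) (by linarith)
    rw [max_eq_left (by linarith), max_eq_left (by linarith),
      div_le_div_iff₀ (Real.sqrt_pos.2 h1) (Real.sqrt_pos.2 h2)]
    have hr0 : 0 ≤ r - 3 * m := by linarith
    have hs0 : 0 ≤ s - 3 * m := by linarith
    refine (pow_le_pow_iff_left₀ (by positivity) (by positivity) two_ne_zero).1 ?_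
    rw [mul_pow, mul_pow, Real.sq_sqrt h1.le, Real.sq_sqrt h2.le]
    -- Measured from the photon sphere, the difference of the squared cross products factors as `m
    -- (z - y)(4yz + 3m(z + y))`, visibly nonnegative.
    obtain ⟨y, rfl⟩ : ∃ y, r = y + 3 * m := ⟨r - 3 * m, by ring⟩
    obtain ⟨z, rfl⟩ : ∃ z, s = z + 3 * m := ⟨s - 3 * m, by ring⟩
    have hy : 0 ≤ y := by linarith
    have hz : 0 ≤ z := by linarith
    have hyz : 0 ≤ z - y := by linarith
    have : 0 ≤ m * (z - y) * (4 * (y * z) + 3 * m * (z + y)) := by positivity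
    nlinarith

/-! ### The flux form and its exterior derivative -/

/-- The differential of the radial coordinate. -/
noncomputable def dRadiusCLM (p : ℝ × ℝ) : ℝ × ℝ →L[ℝ] ℝ :=
  (radius p)⁻¹ • (p.1 • ContinuousLinearMap.fst ℝ ℝ ℝ + p.2 • ContinuousLinearMap.snd ℝ ℝ ℝ)

theorem dRadiusCLM_apply (p v : ℝ × ℝ) : dRadiusCLM p v = dRadius p v := by
  simp only [dRadiusCLM, dRadius, smul_apply, add_apply, smul_eq_mul,
    ContinuousLinearMap.coe_fst', ContinuousLinearMap.coe_snd']
  ring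

theorem radius_sq (p : ℝ × ℝ) : radius p ^ 2 = p.1 ^ 2 + p.2 ^ 2 :=
  Real.sq_sqrt (by positivity)

theorem sum_sq_ne_zero_of_radius_pos {p : ℝ × ℝ} (hp : 0 < radius p) : p.1 ^ 2 + p.2 ^ 2 ≠ 0 := by
  rw [← radius_sq]; positivity

theorem hasFDerivAt_radius {p : ℝ × ℝ} (hp : 0 < radius p) :
    HasFDerivAt radius (dRadiusCLM p) p := by
  have h := (((hasFDerivAt_fst (𝕜 := ℝ) (p := p)).pow 2).add
    ((hasFDerivAt_snd (𝕜 := ℝ) (p := p)).pow 2)).sqrt (sum_sq_ne_zero_of_radius_pos hp)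
  refine h.congr_fderiv ?_
  ext <;> simp [dRadiusCLM, radius] <;> field_simp

theorem contDiffAt_radius {n : WithTop ℕ∞} {p : ℝ × ℝ} (hp : 0 < radius p) :
    ContDiffAt ℝ n radius p :=
  ((contDiffAt_fst.pow 2).add (contDiffAt_snd.pow 2)).sqrt (sum_sq_ne_zero_of_radius_pos hp)

theorem radius_pos_of_mem_exterior (hm : 0 < m) {p : ℝ × ℝ} (hp : p ∈ exterior m) :
    0 < radius p :=
  lt_trans (by positivity) (show 2 * m < radius p from hp)

/-- The one-form `½ (profile m r) dφ`, the pull-back of the flat `½ R² dφ` under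
`R = √(profile m r)`. -/
noncomputable def fluxForm (m : ℝ) (p : ℝ × ℝ) : ℝ × ℝ →L[ℝ] ℝ :=
  (profile m (radius p) / (2 * radius p ^ 2)) •
    (p.1 • ContinuousLinearMap.snd ℝ ℝ ℝ - p.2 • ContinuousLinearMap.fst ℝ ℝ ℝ)

theorem fluxForm_apply (m : ℝ) (p v : ℝ × ℝ) :
    fluxForm m p v = profile m (radius p) / (2 * radius p ^ 2) * (p.1 * v.2 - p.2 * v.1) := by
  simp [fluxForm]

theorem contDiffAt_profile (hr : 2 * m < r) : ContDiffAt ℝ 1 (profile m) r := by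
  have h1 : ContDiffAt ℝ 1 (fun r => max (r - 3 * m) 0 ^ 2) r :=
    contDiff_max_zero_sq.contDiffAt.comp r (contDiffAt_id.sub contDiffAt_const)
  exact contDiffAt_const.add (h1.mul ((contDiffAt_id.add contDiffAt_const).div
    (contDiffAt_id.sub contDiffAt_const) (sub_pos.2 hr).ne'))

theorem contDiffOn_fluxForm (hm : 0 < m) : ContDiffOn ℝ 1 (fluxForm m) (exterior m) := by
  intro p hp
  have hr := radius_pos_of_mem_exterior hm hp
  refine ContDiffAt.contDiffWithinAt ?_
  have h1 : ContDiffAt ℝ 1 (fun p => profile m (radius p)) p :=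
    (contDiffAt_profile hp).comp p (contDiffAt_radius hr)
  have h2 : ContDiffAt ℝ 1 (fun p => profile m (radius p) / (2 * radius p ^ 2)) p :=
    h1.div (contDiffAt_const.mul ((contDiffAt_radius hr).pow 2)) (by positivity)
  exact h2.smul ((contDiffAt_fst.smul contDiffAt_const).sub
    (contDiffAt_snd.smul contDiffAt_const))

theorem areaDensity_eq (hm : 0 < m) {p : ℝ × ℝ} (hp : p ∈ exterior m) :
    areaDensity m p = √((radius p / (radius p - 2 * m)) ^ 3) := by
  have hr := radius_pos_of_mem_exterior hm hp
  have hx : 0 < radius p - 2 * m := sub_pos.2 hp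
  have h2 := radius_sq p
  unfold areaDensity optMetric dRadius dAngle
  congr 1
  have e : (1 - 2 * m / radius p) = (radius p - 2 * m) / radius p := by field_simp
  rw [e]
  simp only [mul_one, mul_zero, add_zero, zero_add, zero_sub]
  have e4 : (p.1 ^ 2 + p.2 ^ 2) ^ 2 = radius p ^ 4 := by rw [← h2]; ring
  field_simp
  linear_combination radius p * (radius p - 2 * m) * e4

/-- As `d(½ u(r) dφ) = u'(r)/(2r) dx ∧ dy`, only `profileDeriv` enters; dividing by the optical
density `(r/(r - 2m))^(3/2)` leaves `areaRatio`. -/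
theorem extDer_fluxForm (hm : 0 < m) {p : ℝ × ℝ} (hp : p ∈ exterior m) :
    extDer (fluxForm m) p = areaRatio m (radius p) * areaDensity m p := by
  have hr := radius_pos_of_mem_exterior hm hp
  have hx : 0 < radius p - 2 * m := sub_pos.2 hp
  have hu : HasDerivAt (fun r => profile m r / (2 * r ^ 2))
      ((profileDeriv m (radius p) * (2 * radius p ^ 2) - profile m (radius p) * (2 * (2 * radius p)))
        / (2 * radius p ^ 2) ^ 2) (radius p) := by
    refine (hasDerivAt_profile hp).div ?_ (by positivity)
    simpa using (hasDerivAt_pow 2 (radius p)).const_mul 2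
  have hk := hu.comp_hasFDerivAt p (hasFDerivAt_radius hr)
  have hω : HasFDerivAt (fun p : ℝ × ℝ => p.1 • ContinuousLinearMap.snd ℝ ℝ ℝ
      - p.2 • ContinuousLinearMap.fst ℝ ℝ ℝ) _ p :=
    ((hasFDerivAt_fst (𝕜 := ℝ) (p := p)).smul_const (ContinuousLinearMap.snd ℝ ℝ ℝ)).sub
      ((hasFDerivAt_snd (𝕜 := ℝ) (p := p)).smul_const (ContinuousLinearMap.fst ℝ ℝ ℝ))
  have hη : HasFDerivAt (fluxForm m) _ p := hk.smul hω
  have h1 : extDer (fluxForm m) p = profileDeriv m (radius p) / (2 * radius p) := by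
    rw [extDer, hη.fderiv]
    have h2 : p.2 ^ 2 = radius p ^ 2 - p.1 ^ 2 := by rw [radius_sq]; ring
    simp [dRadiusCLM]
    field_simp
    ring_nf
    simp only [h2]
    ring
  rw [h1, areaDensity_eq hm hp, areaRatio, profileDeriv]
  set s := radius p
  set y := max (s - 3 * m) 0
  have e : √((s / (s - 2 * m)) ^ 3) = s / (s - 2 * m) ^ 2 * √(s * (s - 2 * m)) := by
    rw [Real.sqrt_eq_iff_mul_self_eq (by positivity) (by positivity)]
    have := Real.mul_self_sqrt (mul_pos hr hx).le
    rw [mul_mul_mul_comm, this]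
    field_simp
  rw [e]
  have := (Real.sqrt_pos.2 (mul_pos hr hx)).ne'
  field_simp

/-! ### Contraction to the flat plane and the inequality for one loop -/

variable {c : ℝ}

theorem optMetric_self_nonneg (hm : 0 < m) {p : ℝ × ℝ} (hp : p ∈ exterior m) (v : ℝ × ℝ) :
    0 ≤ optMetric m p v v := by
  have hr := radius_pos_of_mem_exterior hm hp
  have hx : 0 < 1 - 2 * m / radius p := by
    rw [sub_pos, div_lt_one hr]; exact hp
  have h1 := mul_self_nonneg (dRadius p v)
  have h2 := mul_self_nonneg (dAngle p v)
  unfold optMetric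
  positivity

theorem continuousOn_sqrt_optMetric (hm : 0 < m) :
    ContinuousOn (fun z : (ℝ × ℝ) × (ℝ × ℝ) => √(optMetric m z.1 z.2 z.2))
      (exterior m ×ˢ univ) := by
  have hr : ∀ z ∈ exterior m ×ˢ (univ : Set (ℝ × ℝ)), radius z.1 ≠ 0 := fun z hz =>
    (radius_pos_of_mem_exterior hm hz.1).ne'
  have hx : ∀ z ∈ exterior m ×ˢ (univ : Set (ℝ × ℝ)), 1 - 2 * m / radius z.1 ≠ 0 := by
    intro z hz
    have : 0 < 1 - 2 * m / radius z.1 := by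
      rw [sub_pos, div_lt_one (radius_pos_of_mem_exterior hm hz.1)]; exact hz.1
    exact this.ne'
  have hrad : ContinuousOn (fun z : (ℝ × ℝ) × (ℝ × ℝ) => radius z.1) (exterior m ×ˢ univ) :=
    (continuous_radius.comp continuous_fst).continuousOn
  have hf : ContinuousOn (fun z : (ℝ × ℝ) × (ℝ × ℝ) => 1 - 2 * m / radius z.1)
      (exterior m ×ˢ univ) := continuousOn_const.sub (continuousOn_const.div hrad hr)
  have hdr : ContinuousOn (fun z : (ℝ × ℝ) × (ℝ × ℝ) => dRadius z.1 z.2) (exterior m ×ˢ univ) :=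
    ContinuousOn.div (Continuous.continuousOn (by fun_prop)) hrad hr
  have hda : ContinuousOn (fun z : (ℝ × ℝ) × (ℝ × ℝ) => dAngle z.1 z.2) (exterior m ×ˢ univ) :=
    ContinuousOn.div (Continuous.continuousOn (by fun_prop)) (hrad.pow 2)
      fun z hz => pow_ne_zero 2 (hr z hz)
  unfold optMetric
  exact (((continuousOn_const.div (hf.pow 2) fun z hz => pow_ne_zero 2 (hx z hz)).mul
    (hdr.mul hdr)).add (((hrad.pow 2).div hf hx).mul (hda.mul hda))).sqrt

/-- The radial stretch factor of the map to the flat plane. -/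
noncomputable def stretch (m r : ℝ) : ℝ := √(profile m r) / r

/-- The derivative of `stretch m`. -/
noncomputable def stretchDeriv (m r : ℝ) : ℝ :=
  profileDeriv m r / (2 * √(profile m r)) / r - √(profile m r) / r ^ 2

theorem hasDerivAt_stretch {r : ℝ} (hm : 0 < m) (hr : 2 * m < r) :
    HasDerivAt (stretch m) (stretchDeriv m r) r := by
  have hr0 : r ≠ 0 := by linarith
  have := ((hasDerivAt_profile hr).sqrt (profile_pos hm hr).ne').div (hasDerivAt_id r) hr0
  refine this.congr_deriv ?_
  simp only [stretchDeriv, id]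
  field_simp

theorem continuousOn_profile (m : ℝ) : ContinuousOn (profile m) (Ioi (2 * m)) := fun _ hr =>
  (hasDerivAt_profile hr).continuousAt.continuousWithinAt

theorem continuousOn_profileDeriv (m : ℝ) : ContinuousOn (profileDeriv m) (Ioi (2 * m)) := by
  unfold profileDeriv
  refine ContinuousOn.div (Continuous.continuousOn (by fun_prop))
    (Continuous.continuousOn (by fun_prop)) fun r hr => pow_ne_zero 2 ?_
  exact (sub_pos.2 hr).ne'

theorem continuousOn_stretch (hm : 0 < m) : ContinuousOn (stretch m) (Ioi (2 * m)) := fun _ hr =>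
  (hasDerivAt_stretch hm hr).continuousAt.continuousWithinAt

theorem continuousOn_stretchDeriv (hm : 0 < m) :
    ContinuousOn (stretchDeriv m) (Ioi (2 * m)) := by
  have h0 : ∀ r ∈ Ioi (2 * m), r ≠ 0 := fun r hr => by
    have : 2 * m < r := hr
    linarith
  have hs := (continuousOn_profile m).sqrt
  exact (((continuousOn_profileDeriv m).div (continuousOn_const.mul hs) fun r hr =>
    mul_ne_zero two_ne_zero (Real.sqrt_pos.2 (profile_pos hm hr)).ne').div continuousOn_id h0).sub
      (hs.div (continuousOn_id.pow 2) fun r hr => pow_ne_zero 2 (h0 r hr))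

/-- The map `(r, φ) ↦ (√(profile m r), φ)` to the flat plane is a contraction. -/
theorem stretch_speed_sq_le (hm : 0 < m) {p : ℝ × ℝ} (hp : p ∈ exterior m) (v : ℝ × ℝ) :
    (stretchDeriv m (radius p) * dRadius p v * p.1 + stretch m (radius p) * v.1) ^ 2
      + (stretchDeriv m (radius p) * dRadius p v * p.2 + stretch m (radius p) * v.2) ^ 2
      ≤ optMetric m p v v := by
  have hr := radius_pos_of_mem_exterior hm hp
  have hu := profile_pos hm (show 2 * m < radius p from hp)
  have hs := Real.sqrt_pos.2 hu
  have hv : v.1 ^ 2 + v.2 ^ 2 = dRadius p v ^ 2 + radius p ^ 2 * dAngle p v ^ 2 := by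
    unfold dRadius dAngle
    field_simp
    rw [radius_sq]
    ring
  have hpv : p.1 * v.1 + p.2 * v.2 = radius p * dRadius p v := by
    unfold dRadius
    field_simp
  have e1 : (stretchDeriv m (radius p) * dRadius p v * p.1 + stretch m (radius p) * v.1) ^ 2
      + (stretchDeriv m (radius p) * dRadius p v * p.2 + stretch m (radius p) * v.2) ^ 2
      = (stretchDeriv m (radius p) * radius p + stretch m (radius p)) ^ 2 * dRadius p v ^ 2
        + (stretch m (radius p) * radius p) ^ 2 * dAngle p v ^ 2 := by
    linear_combination -(stretchDeriv m (radius p) * dRadius p v) ^ 2 * radius_sq p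
      + 2 * stretchDeriv m (radius p) * dRadius p v * stretch m (radius p) * hpv
      + stretch m (radius p) ^ 2 * hv
  have e2 : (stretchDeriv m (radius p) * radius p + stretch m (radius p)) ^ 2
      = profileDeriv m (radius p) ^ 2 / (4 * profile m (radius p)) := by
    have : stretchDeriv m (radius p) * radius p + stretch m (radius p)
        = profileDeriv m (radius p) / (2 * √(profile m (radius p))) := by
      unfold stretchDeriv stretch
      field_simp
      ring
    rw [this, div_pow, mul_pow, Real.sq_sqrt hu.le]
    norm_num
  have e3 : (stretch m (radius p) * radius p) ^ 2 = profile m (radius p) := by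
    rw [stretch, div_mul_cancel₀ _ hr.ne', Real.sq_sqrt hu.le]
  rw [e1, e2, e3, optMetric, ← sq, ← sq]
  exact add_le_add (mul_le_mul_of_nonneg_right (profileDeriv_sq_le hm hp) (sq_nonneg _))
    (mul_le_mul_of_nonneg_right (profile_le hm hp) (sq_nonneg _))

/-- Each loop satisfies the flat isoperimetric inequality for the pulled back flat area. -/
theorem four_pi_mul_lineIntegral_fluxForm_le (hm : 0 < m) {γ : ℝ → ℝ × ℝ} (h : IsLoop m γ) :
    4 * Real.pi * lineIntegral (fluxForm m) γ ≤ loopLength m γ ^ 2 := by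
  obtain ⟨N, hN, hsm⟩ := h.exists_countable_contDiffAt
  have hmem : ∀ t ∈ Ioo 0 1 \ N, γ t ∈ exterior m := fun t ht =>
    h.mem t ⟨ht.1.1.le, ht.1.2.le⟩
  have hrad : ContinuousOn (fun t => radius (γ t)) (Icc 0 1) :=
    continuous_radius.comp_continuousOn h.continuousOn
  have hst : ContinuousOn (fun t => stretch m (radius (γ t))) (Icc 0 1) :=
    (continuousOn_stretch hm).comp hrad h.mem
  have hd : ∀ t ∈ Ioo 0 1 \ N, HasDerivAt γ (deriv γ t) t := fun t ht =>
    ((hsm t ht).differentiableAt (by simp)).hasDerivAt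
  have hdr : ∀ t ∈ Ioo 0 1 \ N,
      HasDerivAt (fun t => radius (γ t)) (dRadius (γ t) (deriv γ t)) t := fun t ht => by
    have := (hasFDerivAt_radius (radius_pos_of_mem_exterior hm (hmem t ht))).comp_hasDerivAt t
      (hd t ht)
    rwa [dRadiusCLM_apply] at this
  have hds : ∀ t ∈ Ioo 0 1 \ N, HasDerivAt (fun t => stretch m (radius (γ t)))
      (stretchDeriv m (radius (γ t)) * dRadius (γ t) (deriv γ t)) t := fun t ht =>
    HasDerivAt.comp (h₂ := stretch m) t (hasDerivAt_stretch hm (hmem t ht)) (hdr t ht)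
  have hradz : ContinuousOn (fun z : (ℝ × ℝ) × (ℝ × ℝ) => radius z.1) (exterior m ×ˢ univ) :=
    (continuous_radius.comp continuous_fst).continuousOn
  have hmaps : MapsTo (fun z : (ℝ × ℝ) × (ℝ × ℝ) => radius z.1) (exterior m ×ˢ univ)
      (Ioi (2 * m)) := fun z hz => hz.1
  have hdrz : ContinuousOn (fun z : (ℝ × ℝ) × (ℝ × ℝ) => dRadius z.1 z.2) (exterior m ×ˢ univ) :=
    ContinuousOn.div (Continuous.continuousOn (by fun_prop)) hradz
      fun z hz => (radius_pos_of_mem_exterior hm hz.1).ne'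
  have hcs := (continuousOn_stretch hm).comp hradz hmaps
  have hcd := ((continuousOn_stretchDeriv hm).comp hradz hmaps).mul hdrz
  -- In Cartesian coordinates the image curve is `stretch · γ`, so no choice of angle along the loop
  -- is needed. Its speed is bounded by the optical speed.
  have key := planar_isoperimetric_inequality hN
    (x := fun t => stretch m (radius (γ t)) * (γ t).1)
    (y := fun t => stretch m (radius (γ t)) * (γ t).2)
    (p := fun t => stretchDeriv m (radius (γ t)) * dRadius (γ t) (deriv γ t) * (γ t).1
      + stretch m (radius (γ t)) * (deriv γ t).1)
    (q := fun t => stretchDeriv m (radius (γ t)) * dRadius (γ t) (deriv γ t) * (γ t).2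
      + stretch m (radius (γ t)) * (deriv γ t).2)
    (v := fun t => √(optMetric m (γ t) (deriv γ t) (deriv γ t)))
    (hst.mul (continuous_fst.comp_continuousOn h.continuousOn))
    (hst.mul (continuous_snd.comp_continuousOn h.continuousOn))
    (fun t ht => (hds t ht).mul (hd t ht).fst)
    (fun t ht => (hds t ht).mul (hd t ht).snd)
    (fun t ht => continuousAt_comp_deriv (continuousOn_sqrt_optMetric hm) (hmem t ht) (hsm t ht))
    (fun t => Real.sqrt_nonneg _)
    (fun t ht => by
      rw [Real.sq_sqrt (optMetric_self_nonneg hm (hmem t ht) _)]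
      exact stretch_speed_sq_le hm (hmem t ht) _)
    (h.intervalIntegrable_comp_deriv
      (Φ := fun z => stretchDeriv m (radius z.1) * dRadius z.1 z.2 * z.1.1
        + stretch m (radius z.1) * z.2.1)
      ((hcd.mul (Continuous.continuousOn (by fun_prop))).add
        (hcs.mul (Continuous.continuousOn (by fun_prop)))))
    (h.intervalIntegrable_comp_deriv
      (Φ := fun z => stretchDeriv m (radius z.1) * dRadius z.1 z.2 * z.1.2
        + stretch m (radius z.1) * z.2.2)
      ((hcd.mul (Continuous.continuousOn (by fun_prop))).add
        (hcs.mul (Continuous.continuousOn (by fun_prop)))))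
    (h.intervalIntegrable_comp_deriv (continuousOn_sqrt_optMetric hm))
    (by simp only [h.closed]) (by simp only [h.closed])
  have e : lineIntegral (fluxForm m) γ = ∫ t in (0 : ℝ)..1, 2⁻¹ *
      (stretch m (radius (γ t)) * (γ t).1 *
        (stretchDeriv m (radius (γ t)) * dRadius (γ t) (deriv γ t) * (γ t).2
          + stretch m (radius (γ t)) * (deriv γ t).2)
      - stretch m (radius (γ t)) * (γ t).2 *
        (stretchDeriv m (radius (γ t)) * dRadius (γ t) (deriv γ t) * (γ t).1
          + stretch m (radius (γ t)) * (deriv γ t).1)) := by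
    refine intervalIntegral.integral_congr fun t ht => ?_
    rw [uIcc_of_le zero_le_one] at ht
    have hr := radius_pos_of_mem_exterior hm (h.mem t ht)
    have hs : stretch m (radius (γ t)) ^ 2 = profile m (radius (γ t)) / radius (γ t) ^ 2 := by
      rw [stretch, div_pow, Real.sq_sqrt (profile_pos hm (h.mem t ht)).le]
    have e2 : profile m (radius (γ t)) / (2 * radius (γ t) ^ 2)
        = 2⁻¹ * stretch m (radius (γ t)) ^ 2 := by
      rw [hs]; field_simp
    simp only [fluxForm_apply, e2]
    ring
  rw [e, intervalIntegral.integral_const_mul]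
  unfold loopLength
  linarith

/-! ### Round circles: flux, length and admissibility -/

theorem lineIntegral_fluxForm_circle {ρ : ℝ} (hρ : 0 < ρ) :
    lineIntegral (fluxForm m) (circle ρ) = Real.pi * profile m ρ := by
  have : ∀ t, fluxForm m (circle ρ t) (deriv (circle ρ) t) = Real.pi * profile m ρ := by
    intro t
    rw [fluxForm_apply, radius_circle hρ.le, deriv_circle]
    simp only [circle, angularVector, Prod.smul_mk, smul_eq_mul]
    field_simp
    linear_combination profile m ρ * Real.sin_sq_add_cos_sq (2 * Real.pi * t)
  simp [lineIntegral, this]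

theorem circle_mem_exterior (hm : 0 < m) {ρ : ℝ} (hρ : 2 * m < ρ) (t : ℝ) :
    circle ρ t ∈ exterior m := by
  show 2 * m < radius (circle ρ t)
  rwa [radius_circle (by linarith)]

theorem loopLength_circle (hm : 0 < m) {ρ : ℝ} (hρ : 3 * m ≤ ρ) :
    loopLength m (circle ρ) = 2 * Real.pi * √(profile m ρ) := by
  have hρ0 : 0 < ρ := by linarith
  have hx : 0 < ρ - 2 * m := by linarith
  have : ∀ t, √(optMetric m (circle ρ t) (deriv (circle ρ) t) (deriv (circle ρ) t))
      = 2 * Real.pi * √(profile m ρ) := by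
    intro t
    have h1 : dRadius (circle ρ t) (deriv (circle ρ) t) = 0 := by
      rw [dRadius, deriv_circle]
      simp only [circle, angularVector, Prod.smul_mk, smul_eq_mul]
      ring
    have h2 : dAngle (circle ρ t) (deriv (circle ρ) t) = 2 * Real.pi := by
      rw [dAngle, deriv_circle, radius_circle hρ0.le]
      simp only [circle, angularVector, Prod.smul_mk, smul_eq_mul]
      field_simp
      linear_combination Real.sin_sq_add_cos_sq (2 * Real.pi * t)
    have hprof : ρ ^ 2 / (1 - 2 * m / ρ) = profile m ρ := by
      rw [profile_eq_of_le hm hρ]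
      field_simp
    rw [optMetric, h1, h2, radius_circle hρ0.le, hprof, mul_zero, mul_zero, zero_add,
      Real.sqrt_mul (profile_pos hm (by linarith)).le, Real.sqrt_mul_self (by positivity)]
    ring
  simp [loopLength, this]

theorem isCompact_photonAnnulus (m c : ℝ) : IsCompact (photonAnnulus m c) := by
  refine Metric.isCompact_of_isClosed_isBounded
    ((isClosed_le continuous_const continuous_radius).inter
      (isClosed_le continuous_radius continuous_const)) ?_
  refine (Metric.isBounded_closedBall (x := (0 : ℝ × ℝ)) (r := c)).subset fun p hp => ?_
  have h1 := radius_sq p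
  have h0 : 0 ≤ radius p := Real.sqrt_nonneg _
  rw [mem_closedBall_zero_iff, Prod.norm_def, max_le_iff, Real.norm_eq_abs, Real.norm_eq_abs]
  refine ⟨(abs_le_of_sq_le_sq ?_ h0).trans hp.2, (abs_le_of_sq_le_sq ?_ h0).trans hp.2⟩
  · nlinarith [sq_nonneg p.2]
  · nlinarith [sq_nonneg p.1]

theorem photonAnnulus_subset_exterior (hm : 0 < m) : photonAnnulus m c ⊆ exterior m :=
  fun p hp => lt_of_lt_of_le (by linarith) (show 3 * m ≤ radius p from hp.1)

theorem isLoop_circle (hm : 0 < m) {ρ : ℝ} (hρ : 2 * m < ρ) : IsLoop m (circle ρ) := by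
  have hc : ContDiff ℝ ∞ (circle ρ) := by
    unfold circle
    fun_prop
  refine ⟨fun t _ => circle_mem_exterior hm hρ t, hc.continuous.continuousOn, ?_, 1, ![0, 1], ?_,
    rfl, rfl, fun _ => hc.contDiffOn⟩
  · simp [circle]
  · intro i j hij
    fin_cases i <;> fin_cases j <;> simp_all

theorem isCompetitor_circle (hm : 0 < m) (hc : 3 * m ≤ c) : IsCompetitor m c ![circle c] := by
  refine ⟨fun i => ?_, fun η _ _ => rfl, photonAnnulus m c, ∅, ⟨?_, MeasurableSet.empty,
    ⟨photonAnnulus m c, isCompact_photonAnnulus m c, photonAnnulus_subset_exterior hm,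
      Subset.rfl, empty_subset _⟩, fun p hp => hp.1, fun p hp => hp.elim, fun η hη => ?_⟩, ?_⟩
  · fin_cases i
    exact isLoop_circle hm (by linarith)
  · exact (isCompact_photonAnnulus m c).measurableSet
  · have := lineIntegral_circle_sub_lineIntegral_circle (isOpen_exterior m) hη
      (by positivity : 0 < 3 * m) hc (photonAnnulus_subset_exterior hm)
    simpa [cycleIntegral, photonAnnulus] using this
  · simp [area]

/-! ### Comparison at fixed net area and conclusion -/

theorem continuousOn_areaDensity (hm : 0 < m) : ContinuousOn (areaDensity m) (exterior m) := by
  refine ContinuousOn.congr (f := fun p => √((radius p / (radius p - 2 * m)) ^ 3)) ?_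
    fun p hp => areaDensity_eq hm hp
  refine ((continuous_radius.continuousOn.div
    (continuous_radius.sub continuous_const).continuousOn fun p hp => ?_).pow 3).sqrt
  exact (sub_pos.2 hp).ne'

/-- Among regions of equal net area, the annulus has the least flat area of the image. -/
theorem setIntegral_extDer_fluxForm_le (hm : 0 < m) (hc : 3 * m ≤ c) {k : ℕ}
    {C : Fin k → ℝ → ℝ × ℝ} {S T : Set (ℝ × ℝ)} (h : BoundWithPhotonSphere m C S T)
    (harea : area m S - area m T = area m (photonAnnulus m c)) :
    ∫ p in photonAnnulus m c, extDer (fluxForm m) p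
      ≤ (∫ p in S, extDer (fluxForm m) p) - ∫ p in T, extDer (fluxForm m) p := by
  obtain ⟨K, hK, hKm, hSK, hTK⟩ := h.compactly_contained
  set A := photonAnnulus m c
  have hAc : IsCompact A := isCompact_photonAnnulus m c
  have hAm : MeasurableSet A := hAc.measurableSet
  have hA : A ⊆ exterior m := photonAnnulus_subset_exterior hm
  set lam := areaRatio m c
  -- `lam` acts as a Lagrange multiplier: `g ≤ 0` where `r ≤ c` and `g ≥ 0` where `r ≥ c`, while the
  -- `lam` terms drop out of the comparison by the area constraint. Enlarging `S` beyond the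
  -- annulus, leaving parts of the annulus out, and subtracting `T` can each only raise the net
  -- integral of `g`.
  set g : ℝ × ℝ → ℝ := fun p => extDer (fluxForm m) p - lam * areaDensity m p with hg
  have hDc := continuousOn_extDer (isOpen_exterior m) (contDiffOn_fluxForm hm)
  have hρc := continuousOn_areaDensity hm
  have hDi : ∀ {B L : Set (ℝ × ℝ)}, IsCompact L → L ⊆ exterior m → B ⊆ L →
      IntegrableOn (extDer (fluxForm m)) B := fun hL hLm hB =>
    ((hDc.mono hLm).integrableOn_compact hL).mono_set hB
  have hρi : ∀ {B L : Set (ℝ × ℝ)}, IsCompact L → L ⊆ exterior m → B ⊆ L →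
      IntegrableOn (areaDensity m) B := fun hL hLm hB =>
    ((hρc.mono hLm).integrableOn_compact hL).mono_set hB
  have hgi : ∀ {B L : Set (ℝ × ℝ)}, IsCompact L → L ⊆ exterior m → B ⊆ L →
      IntegrableOn g B := fun hL hLm hB => (hDi hL hLm hB).sub ((hρi hL hLm hB).const_mul lam)
  have hint : ∀ {B L : Set (ℝ × ℝ)}, IsCompact L → L ⊆ exterior m → B ⊆ L →
      ∫ p in B, g p = (∫ p in B, extDer (fluxForm m) p) - lam * area m B := by
    intro B L hL hLm hB
    rw [area, ← integral_const_mul]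
    exact integral_sub (hDi hL hLm hB) ((hρi hL hLm hB).const_mul lam)
  have hgeq : ∀ p ∈ exterior m, g p = (areaRatio m (radius p) - lam) * areaDensity m p := by
    intro p hp
    simp only [hg, extDer_fluxForm hm hp]
    ring
  have hle : ∀ p ∈ exterior m, radius p ≤ c → g p ≤ 0 := by
    intro p hp hpc
    rw [hgeq p hp]
    exact mul_nonpos_of_nonpos_of_nonneg (sub_nonpos.2 (areaRatio_mono hm hp hpc))
      (Real.sqrt_nonneg _)
  have hge : ∀ p ∈ exterior m, c ≤ radius p → 0 ≤ g p := by
    intro p hp hpc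
    rw [hgeq p hp]
    exact mul_nonneg (sub_nonneg.2 (areaRatio_mono hm (by linarith) hpc)) (Real.sqrt_nonneg _)
  have h1 : 0 ≤ ∫ p in S \ A, g p := by
    refine setIntegral_nonneg (h.measurable_out.diff hAm) fun p hp => ?_
    refine hge p (hKm (hSK hp.1)) ?_
    by_contra! hlt
    exact hp.2 ⟨h.out_subset p hp.1, hlt.le⟩
  have h2 : ∫ p in A \ S, g p ≤ 0 :=
    setIntegral_nonpos (hAm.diff h.measurable_out) fun p hp => hle p (hA hp.1) hp.1.2
  have h3 : ∫ p in T, g p ≤ 0 := setIntegral_nonpos h.measurable_in fun p hp =>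
    hle p (hKm (hTK hp)) ((h.in_subset p hp).trans hc)
  have h4 := integral_inter_add_sdiff hAm (hgi hK hKm hSK)
  have h5 := integral_inter_add_sdiff h.measurable_out (hgi hAc hA Subset.rfl)
  rw [inter_comm] at h5
  rw [hint hK hKm hSK] at h4
  rw [hint hAc hA Subset.rfl] at h5
  rw [hint hK hKm hTK] at h3
  rw [← harea] at h5
  nlinarith

theorem cycleLength_circle_le (hm : 0 < m) (hc : 3 * m ≤ c) {k : ℕ} {C : Fin k → ℝ → ℝ × ℝ}
    (h : IsCompetitor m c C) : cycleLength m ![circle c] ≤ cycleLength m C := by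
  obtain ⟨S, T, hST, harea⟩ := h.area_eq
  have h1 := setIntegral_extDer_fluxForm_le hm hc hST harea
  rw [← hST.stokes _ (contDiffOn_fluxForm hm)] at h1
  have h2 := lineIntegral_circle_sub_lineIntegral_circle (isOpen_exterior m)
    (contDiffOn_fluxForm hm) (by positivity : 0 < 3 * m) hc (photonAnnulus_subset_exterior hm)
  have h3 : Real.pi * profile m c ≤ cycleIntegral (fluxForm m) C := by
    rw [← lineIntegral_fluxForm_circle (by linarith)]
    unfold photonAnnulus at h1
    linarith
  have hnn : ∀ i ∈ Finset.univ, 0 ≤ loopLength m (C i) := fun i _ =>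
    intervalIntegral.integral_nonneg zero_le_one fun t _ => Real.sqrt_nonneg _
  have h4 : 4 * Real.pi * cycleIntegral (fluxForm m) C ≤ cycleLength m C ^ 2 := by
    -- Splitting into several loops does not help: `∑ Lᵢ² ≤ (∑ Lᵢ)²`.
    refine le_trans ?_ (Finset.sum_sq_le_sq_sum_of_nonneg hnn)
    rw [cycleIntegral, Finset.mul_sum]
    exact Finset.sum_le_sum fun i _ => four_pi_mul_lineIntegral_fluxForm_le hm (h.loop i)
  have h5 : cycleLength m ![circle c] = 2 * Real.pi * √(profile m c) := by
    simp [cycleLength, loopLength_circle hm hc]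
  rw [h5]
  have h6 : 0 ≤ cycleLength m C := Finset.sum_nonneg hnn
  refine (abs_le_of_sq_le_sq' ?_ h6).2
  rw [mul_pow, Real.sq_sqrt (profile_pos hm (by linarith)).le]
  nlinarith [mul_le_mul_of_nonneg_left h3 (by positivity : 0 ≤ 4 * Real.pi)]

end SchwarzschildOptical

theorem theorem1 (m c : ℝ) (hm : 0 < m) (hc : 3 * m ≤ c) :
    SchwarzschildOptical.IsCompetitor m c ![SchwarzschildOptical.circle c] ∧
    ∀ (k : ℕ) (C : Fin k → ℝ → ℝ × ℝ), SchwarzschildOptical.IsCompetitor m c C →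
      SchwarzschildOptical.cycleLength m ![SchwarzschildOptical.circle c]
        ≤ SchwarzschildOptical.cycleLength m C :=
  ⟨SchwarzschildOptical.isCompetitor_circle hm hc, fun _ _ h =>
    SchwarzschildOptical.cycleLength_circle_le hm hc h⟩
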